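/- Let $K$ be a non-compact locally compact Hausdorff hypergroup that carries a left-invariant Haar measure $\omega$, i.e. a non-zero Radon measure with $\delta_x*\omega=\omega$ for all $x\in K$. Here $M(K)=C_0(K)^*$ is the space of bounded regular complex Borel measures on $K$, and "hypergroup" means that $M(K)$ carries a bilinear, associative, weakly continuous convolution, given by $$\int_K f\,d(\mu*\nu)=\int_K\int_K f(x*y)\,d\mu(x)\,d\nu(y),\qquad f(x*y)=\int_K f\,d(\delta_x*\delta_y),\quad f\in C_0(K),$$ such that: each $\delta_x*\delta_y$ is a probability measure with compact support; the maps $(x,y)\mapsto\delta_x*\delta_y$ (for the weak$^*$ topology) and $(x,y)\mapsto\operatorname{supp}(\delta_x*\delta_y)$ (for the Michael topology on non-empty compact sets) are continuous; there is an identity $e\in K$ with $\delta_e*\delta_x=\delta_x*\delta_e=\delta_x$; and there is a continuous involution $x\mapsto\check x$ on $K$ with $(\delta_x*\delta_y)\check{}=\delta_{\check y}*\delta_{\check x}$ and $e\in\operatorname{supp}(\delta_x*\delta_y)$ if and only if $x=\check y$. Let $\sigma$ be a regular Borel probability measure on $K$ that is non-degenerate, i.e. $K=\overline{\bigcup_{n\ge1}(\operatorname{supp}\sigma)^n}$,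 where $A*B=\bigcup_{x\in A,\,y\in B}\operatorname{supp}(\delta_x*\delta_y)$ for $A,B\subseteq K$, $A^1=A$ and $A^{n+1}=A^n*A$. Let $\sigma^k$ be the $k$-fold convolution power of $\sigma$. Then $\frac1n\sum_{k=1}^n\sigma^k\to0$ weak$^*$ in $M(K)$, i.e. $$\lim_{n\to\infty}\int_K f\,d\Big(\frac1n\sum_{k=1}^n\sigma^k\Big)=0\qquad\text{for every } f\in C_0(K).$$ -/

import Mathlib

open MeasureTheory Filter Topology Set
open scoped ZeroAtInfty CompactlySupported

/-- The finite regular positive Borel measures on `K`: the positive cone of the space `M(K)` of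
bounded regular complex Borel measures. -/
def PosMeasure (K : Type*) [TopologicalSpace K] [MeasurableSpace K] : Type _ :=
  {μ : Measure K // IsFiniteMeasure μ ∧ μ.Regular}

/-- A weak-star continuous family of regular probability measures on `K` indexed by `K × K`;
`mul x y` plays the role of `δ_x * δ_y`. -/
structure PointConvolution (K : Type*) [TopologicalSpace K] [MeasurableSpace K]
    [OpensMeasurableSpace K] where
  mul : K → K → ProbabilityMeasure K
  regular_mul : ∀ x y, (mul x y : Measure K).Regular
  continuous_mul : Continuous fun p : K × K => mul p.1 p.2

section Auxiliary

variable {K : Type*} [TopologicalSpace K] [MeasurableSpace K]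

theorem regular_dirac_of_t1 [T1Space K] [BorelSpace K] (x : K) :
    (Measure.dirac x).Regular where
  lt_top_of_isCompact := fun _ _ => measure_lt_top _ _
  outerRegular := by
    intro A hA r hr
    by_cases hx : x ∈ A
    · refine ⟨univ, subset_univ _, isOpen_univ, ?_⟩
      rwa [Measure.dirac_apply' _ MeasurableSet.univ, indicator_of_mem (mem_univ x),
        ← indicator_of_mem hx (1 : K → ENNReal), ← Measure.dirac_apply' _ hA]
    · refine ⟨{x}ᶜ, fun y hy h => hx (h ▸ hy), isOpen_compl_singleton, ?_⟩
      rw [Measure.dirac_apply' _ (measurableSet_singleton x).compl]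
      simpa using lt_of_le_of_lt zero_le hr
  innerRegular := by
    intro U hU r hr
    by_cases hx : x ∈ U
    · refine ⟨{x}, singleton_subset_iff.2 hx, isCompact_singleton, ?_⟩
      rw [Measure.dirac_apply' _ hU.measurableSet, indicator_of_mem hx] at hr
      rwa [Measure.dirac_apply' _ (measurableSet_singleton x),
        indicator_of_mem (mem_singleton x)]
    · rw [Measure.dirac_apply' _ hU.measurableSet, indicator_of_notMem hx] at hr
      exact absurd hr not_lt_zero

theorem continuous_integral_of_regular [BorelSpace K] [T2Space K] (μ : Measure K)
    [IsFiniteMeasure μ] [μ.Regular] {φ : K → K → ℝ} (hφ : Continuous fun p : K × K => φ p.1 p.2)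
    {C : ℝ} (hC : ∀ x y, |φ x y| ≤ C) : Continuous fun y => ∫ x, φ x y ∂μ := by
  have hint : ∀ y, Integrable (fun x => φ x y) μ := fun y =>
    Integrable.of_bound (by fun_prop : Continuous fun x => φ x y).aestronglyMeasurable C
      (Eventually.of_forall fun x => hC x y)
  rw [continuous_iff_continuousAt]
  intro y₀
  have hC0 : 0 ≤ C := (abs_nonneg _).trans (hC y₀ y₀)
  rw [ContinuousAt, Metric.tendsto_nhds]
  intro ε hε
  set m : ℝ := μ.real univ
  have hm : 0 ≤ m := measureReal_nonneg
  set η : ℝ := ε / (m + 2 * C + 2)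
  have hη : 0 < η := by positivity
  obtain ⟨S, -, hS, hSμ⟩ := MeasurableSet.univ.exists_isCompact_sdiff_lt (μ := μ)
    (measure_ne_top μ _) (ε := ENNReal.ofReal η) (by simpa using hη)
  have hSm : MeasurableSet S := hS.measurableSet
  have hSμ' : μ.real Sᶜ ≤ η := by
    rw [compl_eq_univ_sdiff, measureReal_def]
    exact ENNReal.toReal_le_of_le_ofReal hη.le hSμ.le
  have hev : ∀ᶠ y in 𝓝 y₀, ∀ x ∈ S, |φ x y - φ x y₀| < η := by
    refine hS.eventually_forall_of_forall_eventually fun x _ => ?_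
    have h1 : Continuous fun p : K × K => |φ p.2 p.1 - φ p.2 y₀| := by fun_prop
    refine (h1.tendsto (y₀, x)).eventually_lt_const ?_
    simpa using hη
  filter_upwards [hev] with y hy
  rw [Real.dist_eq, ← integral_sub (hint y) (hint y₀)]
  have hi : Integrable (fun x => φ x y - φ x y₀) μ := (hint y).sub (hint y₀)
  rw [← integral_add_compl hSm hi]
  have e1 : |∫ x in S, (φ x y - φ x y₀) ∂μ| ≤ η * m := by
    have := norm_setIntegral_le_of_norm_le_const (μ := μ) (measure_lt_top μ S)
      (f := fun x => φ x y - φ x y₀) (C := η) (fun x hx => (hy x hx).le)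
    refine this.trans ?_
    exact mul_le_mul_of_nonneg_left (measureReal_mono (subset_univ _)) hη.le
  have e2 : |∫ x in Sᶜ, (φ x y - φ x y₀) ∂μ| ≤ (2 * C) * η := by
    have := norm_setIntegral_le_of_norm_le_const (μ := μ) (measure_lt_top μ Sᶜ)
      (f := fun x => φ x y - φ x y₀) (C := 2 * C) (fun x _ => by
        rw [Real.norm_eq_abs]
        have := abs_sub (φ x y) (φ x y₀)
        linarith [hC x y, hC x y₀])
    exact this.trans (mul_le_mul_of_nonneg_left hSμ' (by positivity))
  calc _ ≤ η * m + 2 * C * η := (abs_add_le _ _).trans (add_le_add e1 e2)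
    _ < η * (m + 2 * C + 2) := by nlinarith
    _ = ε := div_mul_cancel₀ _ (by positivity)

end Auxiliary

namespace PointConvolution

variable {K : Type*} [TopologicalSpace K] [MeasurableSpace K] [BorelSpace K]
  (H : PointConvolution K)

/-- `f(x * y) = ∫ f d(δ_x * δ_y)`. -/
noncomputable def translate (f : K → ℝ) (x y : K) : ℝ := ∫ t, f t ∂(H.mul x y : Measure K)

theorem continuous_translate (f : C_c(K, ℝ)) :
    Continuous fun p : K × K => H.translate f p.1 p.2 := by
  obtain ⟨C, hC⟩ := f.hasCompactSupport.exists_bound_of_continuous f.continuous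
  exact (ProbabilityMeasure.continuous_integral_boundedContinuousFunction
    (BoundedContinuousFunction.ofNormedAddCommGroup f f.continuous C hC)).comp H.continuous_mul

theorem abs_translate_le {f : K → ℝ} {C : ℝ} (hC : ∀ t, |f t| ≤ C) (x y : K) :
    |H.translate f x y| ≤ C := by
  have := norm_integral_le_of_norm_le_const (μ := (H.mul x y : Measure K)) (f := f) (C := C)
    (Eventually.of_forall hC)
  simpa [translate] using this

theorem integrable_inner (μ : Measure K) [IsFiniteMeasure μ] (f : C_c(K, ℝ)) (y : K) :
    Integrable (fun x => H.translate f x y) μ := by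
  obtain ⟨C, hC⟩ := f.hasCompactSupport.exists_bound_of_continuous f.continuous
  have h := H.continuous_translate f
  exact Integrable.of_bound
    (h.comp (by fun_prop : Continuous fun x : K => (x, y))).aestronglyMeasurable C
    (Eventually.of_forall fun x => H.abs_translate_le hC x y)

theorem integrable_outer [T2Space K] (μ ν : Measure K) [IsFiniteMeasure μ] [μ.Regular]
    [IsFiniteMeasure ν] (f : C_c(K, ℝ)) :
    Integrable (fun y => ∫ x, H.translate f x y ∂μ) ν := by
  obtain ⟨C, hC⟩ := f.hasCompactSupport.exists_bound_of_continuous f.continuous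
  exact Integrable.of_bound
    (continuous_integral_of_regular μ (H.continuous_translate f)
      (H.abs_translate_le hC)).aestronglyMeasurable (C * μ.real univ)
    (Eventually.of_forall fun y => norm_integral_le_of_norm_le_const
      (Eventually.of_forall fun x => H.abs_translate_le hC x y))

/-- The positive functional `f ↦ ∫∫ f(x * y) dμ(x) dν(y)` on `C_c(K)`. -/
noncomputable def functional [T2Space K] (μ ν : PosMeasure K) : C_c(K, ℝ) →ₚ[ℝ] ℝ :=
  haveI := μ.2.1
  haveI := ν.2.1
  haveI := μ.2.2
  PositiveLinearMap.mk₀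
    { toFun := fun f => ∫ y, ∫ x, H.translate f x y ∂μ.1 ∂ν.1
      map_add' := fun f g => by
        rw [← integral_add (H.integrable_outer μ.1 ν.1 f) (H.integrable_outer μ.1 ν.1 g)]
        refine integral_congr_ae (Eventually.of_forall fun y => ?_)
        dsimp only
        rw [← integral_add (H.integrable_inner μ.1 f y) (H.integrable_inner μ.1 g y)]
        refine integral_congr_ae (Eventually.of_forall fun x => ?_)
        exact integral_add (f.continuous.integrable_of_hasCompactSupport f.hasCompactSupport)
          (g.continuous.integrable_of_hasCompactSupport g.hasCompactSupport)
      map_smul' := fun c f => by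
        simp [translate, integral_const_mul] }
    fun f hf => integral_nonneg fun y => integral_nonneg fun x => integral_nonneg fun t => hf t

/-- The convolution `μ * ν`: the regular measure with
`∫ f d(μ * ν) = ∫∫ f(x * y) dμ(x) dν(y)`, obtained from the Riesz representation theorem. -/
noncomputable def convolve [T2Space K] [LocallyCompactSpace K] (μ ν : PosMeasure K) :
    PosMeasure K :=
  ⟨RealRMK.rieszMeasure (H.functional μ ν), by
    have := μ.2.1
    have := ν.2.1
    have := μ.2.2
    refine ⟨⟨?_⟩, inferInstance⟩
    rw [isOpen_univ.measure_eq_iSup_isCompact]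
    refine lt_of_le_of_lt (b := ENNReal.ofReal (μ.1.real univ * ν.1.real univ))
      (iSup₂_le fun S _ => iSup_le fun hS => ?_) ENNReal.ofReal_lt_top
    obtain ⟨f, hf1, -, hfc, hf01⟩ :=
      exists_continuous_one_zero_of_isCompact hS isClosed_empty (disjoint_empty S)
    let g : C_c(K, ℝ) := ⟨f, hfc⟩
    have hg : ∀ t, |g t| ≤ 1 := fun t => abs_le.2 ⟨(by norm_num : (-1 : ℝ) ≤ 0).trans (hf01 t).1, (hf01 t).2⟩
    refine (RealRMK.rieszMeasure_le_of_eq_one _ (f := g) (fun x => (hf01 x).1) hS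
      (fun x hx => hf1 hx)).trans (ENNReal.ofReal_le_ofReal ?_)
    refine (le_abs_self _).trans ?_
    change ‖∫ y, ∫ x, H.translate g x y ∂μ.1 ∂ν.1‖ ≤ _
    refine norm_integral_le_of_norm_le_const (Eventually.of_forall fun y => ?_)
    refine (norm_integral_le_of_norm_le_const (C := 1)
      (Eventually.of_forall fun x => H.abs_translate_le hg x y)).trans ?_
    rw [one_mul]⟩

theorem integral_convolve [T2Space K] [LocallyCompactSpace K] (μ ν : PosMeasure K)
    (f : C_c(K, ℝ)) :
    ∫ t, f t ∂(H.convolve μ ν).1 = ∫ y, ∫ x, H.translate f x y ∂μ.1 ∂ν.1 :=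
  RealRMK.integral_rieszMeasure _ f

end PointConvolution

/-- A (locally compact) hypergroup. The bilinear convolution on `M(K)` is given by the measures
`mul x y = δ_x * δ_y` through `PointConvolution.convolve`; associativity on `M(K)` is, by
bilinearity, associativity on its positive cone. -/
structure Hypergroup (K : Type*) [TopologicalSpace K] [T2Space K] [LocallyCompactSpace K]
    [MeasurableSpace K] [BorelSpace K] extends PointConvolution K where
  assoc : ∀ μ ν ρ : PosMeasure K, toPointConvolution.convolve
    (toPointConvolution.convolve μ ν) ρ = toPointConvolution.convolve μ
      (toPointConvolution.convolve ν ρ)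
  isCompact_support : ∀ x y, IsCompact (mul x y : Measure K).support
  /-- `(x, y) ↦ supp (δ_x * δ_y)` is continuous for the Michael (Vietoris) topology. -/
  continuous_support : Continuous[inferInstance, TopologicalSpace.vietoris K]
    fun p : K × K => (mul p.1 p.2 : Measure K).support
  /-- The identity `e`. -/
  e : K
  e_mul : ∀ x, (mul e x : Measure K) = Measure.dirac x
  mul_e : ∀ x, (mul x e : Measure K) = Measure.dirac x
  /-- The involution `x ↦ x̌`. -/
  inv : K → K
  continuous_inv : Continuous inv
  inv_inv : ∀ x, inv (inv x) = x
  map_inv_mul : ∀ x y, (mul x y : Measure K).map inv = (mul (inv y) (inv x) : Measure K)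
  e_mem_support_iff : ∀ x y, e ∈ (mul x y : Measure K).support ↔ x = inv y

namespace Hypergroup

variable {K : Type*} [TopologicalSpace K] [T2Space K] [LocallyCompactSpace K]
  [MeasurableSpace K] [BorelSpace K] (H : Hypergroup K)

/-- `ω` is a left Haar measure: a nonzero Radon measure with `δ_x * ω = ω` for all `x`. -/
structure IsLeftHaar (ω : Measure K) : Prop where
  regular : ω.Regular
  ne_zero : ω ≠ 0
  invariant : ∀ (x : K) (f : C_c(K, ℝ)), ∫ y, H.translate f x y ∂ω = ∫ y, f y ∂ω

/-- The point mass `δ_e`. -/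
noncomputable def diracE : PosMeasure K :=
  ⟨Measure.dirac H.e, inferInstance, regular_dirac_of_t1 H.e⟩

/-- The convolution powers: `σ⁰ = δ_e` and `σⁿ⁺¹ = σⁿ * σ`. -/
noncomputable def power (σ : PosMeasure K) : ℕ → PosMeasure K
  | 0 => H.diracE
  | n + 1 => H.convolve (power σ n) σ

/-- The measure `(1/n) ∑_{k=1}^n σᵏ`. -/
noncomputable def cesaro (σ : PosMeasure K) (n : ℕ) : Measure K :=
  ((n : NNReal)⁻¹) • ∑ k ∈ Finset.Icc 1 n, (H.power σ k).1

/-- The product of sets `A * B = ⋃_{x ∈ A, y ∈ B} supp (δ_x * δ_y)`. -/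
def setMul (A B : Set K) : Set K :=
  ⋃ x ∈ A, ⋃ y ∈ B, (H.mul x y : Measure K).support

/-- The powers of a set: `A⁰ = {e}` and `Aⁿ⁺¹ = Aⁿ * A`. -/
def setPow (A : Set K) : ℕ → Set K
  | 0 => {H.e}
  | n + 1 => H.setMul (setPow A n) A

/-- `σ` is non-degenerate: `⋃_{n ≥ 1} (supp σ)ⁿ` is dense in `K`. -/
def IsNondegenerate (σ : PosMeasure K) : Prop :=
  closure (⋃ n : ℕ, ⋃ _ : 1 ≤ n, H.setPow σ.1.support n) = univ

end Hypergroup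

/-!
Let `μ` be a weak-star cluster point of the Cesàro means of `σ`, along an ultrafilter. Telescoping
gives `μ * σ = μ`. Hence for `f ∈ C_c(K)` the function `y ↦ ∫ f(x * y) dμ(x)`, which lies in
`C₀(K)`, is `σ`-harmonic. If it had a positive maximum, the set where the maximum is attained would
be closed and stable under left multiplication by `supp σ`, so all of `K` by non-degeneracy, and a
non-zero constant does not vanish at infinity on a non-compact space. Applied to `±f` this shows
that the function is zero, and its value at `e` is `∫ f dμ`; so `μ = 0`. Every cluster point in
the weak-star compact unit ball is therefore `0`, which is convergence to `0`.
-/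

section CompactlySupported

variable {X : Type*} [TopologicalSpace X] [T2Space X] [LocallyCompactSpace X]

theorem exists_compactlySupported_one_zero {S T : Set X} (hS : IsCompact S) (hT : IsClosed T)
    (hST : Disjoint S T) :
    ∃ χ : C_c(X, ℝ), EqOn χ 1 S ∧ EqOn χ 0 T ∧ ∀ x, χ x ∈ Icc (0 : ℝ) 1 := by
  obtain ⟨f, hfS, hfT, hfc, hf⟩ := exists_continuous_one_zero_of_isCompact hS hT hST
  exact ⟨⟨f, hfc⟩, hfS, hfT, hf⟩

theorem subset_closure_of_forall_exists_pos {A B : Set X}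
    (h : ∀ f : C_c(X, ℝ), 0 ≤ f → ∀ t ∈ A, 0 < f t → ∃ s ∈ B, 0 < f s) : A ⊆ closure B := by
  intro t htA
  by_contra htB
  obtain ⟨f, hft, hfB, hf⟩ := exists_compactlySupported_one_zero (isCompact_singleton (x := t))
    isClosed_closure (disjoint_singleton_left.2 htB)
  obtain ⟨s, hsB, hfs⟩ := h f (fun x => (hf x).1) t htA (by simp [hft (mem_singleton t)])
  exact hfs.ne' (hfB (subset_closure hsB))

theorem exists_compactlySupported_dist_le {E : Type*} [NormedAddCommGroup E] [NormedSpace ℝ E]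
    (f : C₀(X, E)) {ε : ℝ} (hε : 0 < ε) : ∃ g : C_c(X, E), ∀ x, dist (f x) (g x) ≤ ε := by
  obtain ⟨S, hS, hSf⟩ := mem_cocompact.1 (f.zero_at_infty' (Metric.ball_mem_nhds 0 hε))
  obtain ⟨χ, hχS, -, hχ⟩ :=
    exists_compactlySupported_one_zero hS isClosed_empty (disjoint_empty S)
  refine ⟨⟨⟨fun x => χ x • f x, χ.continuous.smul f.continuous⟩, χ.hasCompactSupport.smul_right⟩,
    fun x => ?_⟩
  change dist (f x) (χ x • f x) ≤ ε
  by_cases hx : x ∈ S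
  · simpa [hχS hx] using hε.le
  · have hfx : ‖f x‖ < ε := by simpa using hSf hx
    calc dist (f x) (χ x • f x) = (1 - χ x) * ‖f x‖ := by
          rw [dist_eq_norm, ← norm_smul_of_nonneg (sub_nonneg.2 (hχ x).2), sub_smul, one_smul]
      _ ≤ ‖f x‖ := mul_le_of_le_one_left (norm_nonneg _) (sub_le_self _ (hχ x).1)
      _ ≤ ε := hfx.le

end CompactlySupported

section Support

variable {X : Type*} [TopologicalSpace X] [MeasurableSpace X]

theorem support_dirac [T1Space X] [OpensMeasurableSpace X] (x : X) :
    (Measure.dirac x).support = {x} := by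
  refine Subset.antisymm ?_ (singleton_subset_iff.2 ?_)
  · refine Measure.support_subset_of_isClosed isClosed_singleton ?_
    rw [mem_ae_iff, Measure.dirac_apply' _ (measurableSet_singleton x).compl]
    simp
  · rw [Measure.mem_support_iff_forall]
    intro U hU
    simp [Measure.dirac_apply_of_mem (mem_of_mem_nhds hU)]

theorem integral_pos_iff_exists_mem_support {μ : Measure X} [μ.Regular] {g : X → ℝ}
    (hg : Continuous g) (hg₀ : 0 ≤ g) (hgi : Integrable g μ) :
    0 < ∫ x, g x ∂μ ↔ ∃ t ∈ μ.support, 0 < g t := by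
  refine ⟨fun h => ?_, fun ⟨t, ht, hgt⟩ => ?_⟩
  · contrapose! h
    exact integral_nonpos_of_ae (mem_of_superset Measure.support_mem_ae_of_regular h)
  · rw [integral_pos_iff_support_of_nonneg hg₀ hgi]
    exact (Measure.mem_support_iff_forall t).1 ht _ (hg.isOpen_support.mem_nhds hgt.ne')

theorem eq_of_mem_support_of_le_integral {μ : Measure X} [μ.Regular] (hμ : μ univ ≤ 1)
    {g : X → ℝ} (hg : Continuous g) (hgi : Integrable g μ) {M : ℝ}
    (hM : 0 ≤ M) (hgM : ∀ x, g x ≤ M) (h : M ≤ ∫ x, g x ∂μ) {t : X} (ht : t ∈ μ.support) :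
    g t = M := by
  have : IsFiniteMeasure μ := ⟨hμ.trans_lt ENNReal.one_lt_top⟩
  by_contra hne
  have hpos : 0 < ∫ x, (M - g x) ∂μ :=
    (integral_pos_iff_exists_mem_support (continuous_const.sub hg)
      (fun x => sub_nonneg.2 (hgM x)) ((integrable_const M).sub hgi)).2
      ⟨t, ht, sub_pos.2 ((hgM t).lt_of_ne hne)⟩
  have hmass : μ.real univ * M ≤ M :=
    mul_le_of_le_one_left hM (ENNReal.toReal_le_of_le_ofReal zero_le_one (by simpa using hμ))
  rw [integral_sub (integrable_const M) hgi, integral_const, smul_eq_mul] at hpos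
  linarith

end Support

section Integral

variable {X E : Type*} [TopologicalSpace X] [MeasurableSpace X] [NormedAddCommGroup E]
  [NormedSpace ℝ E]

theorem tendsto_integral_zero_of_isTightMeasureSet [T2Space X] [OpensMeasurableSpace X] {ι : Type*}
    {l : Filter ι} {μ : Measure X} [IsFiniteMeasure μ] (hμ : IsTightMeasureSet {μ})
    {F : ι → X → E} {C : ℝ} (hC : ∀ i x, ‖F i x‖ ≤ C)
    (hF : ∀ S, IsCompact S → TendstoUniformlyOn F 0 l S) :
    Tendsto (fun i => ∫ x, F i x ∂μ) l (𝓝 0) := by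
  refine Metric.tendsto_nhds.2 fun ε hε => ?_
  set η : ℝ := ε / (μ.real univ + |C| + 1)
  have hη : 0 < η := by positivity
  obtain ⟨S, hS, hSμ⟩ := isTightMeasureSet_iff_exists_isCompact_measure_compl_le.1 hμ
    (ENNReal.ofReal η) (ENNReal.ofReal_pos.2 hη)
  have hSη : μ.real Sᶜ ≤ η := ENNReal.toReal_le_of_le_ofReal hη.le (hSμ μ rfl)
  have hSm : MeasurableSet Sᶜ := hS.measurableSet.compl
  filter_upwards [Metric.tendstoUniformlyOn_iff.1 (hF S hS) η hη] with i hi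
  have hbound : ∀ x, ‖F i x‖ ≤ η + Sᶜ.indicator (fun _ => |C|) x := fun x => by
    by_cases hx : x ∈ S
    · simpa [hx] using (hi x hx).le
    · simpa [hx] using (hC i x).trans ((le_abs_self C).trans (le_add_of_nonneg_left hη.le))
  rw [dist_zero_right]
  calc ‖∫ x, F i x ∂μ‖ ≤ ∫ x, η + Sᶜ.indicator (fun _ => |C|) x ∂μ :=
        norm_integral_le_of_norm_le
          ((integrable_const _).add ((integrable_const _).indicator hSm)) (ae_of_all _ hbound)
    _ = μ.real univ * η + μ.real Sᶜ * |C| := by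
        rw [integral_add (integrable_const _) ((integrable_const _).indicator hSm),
          integral_const, integral_indicator_const _ hSm, smul_eq_mul, smul_eq_mul]
    _ ≤ μ.real univ * η + η * |C| := by gcongr
    _ < η * (μ.real univ + |C| + 1) := by linarith
    _ = ε := div_mul_cancel₀ _ (by positivity)

end Integral

section Fubini

variable {X Y E : Type*} [TopologicalSpace X] [T2Space X] [MeasurableSpace X] [BorelSpace X]
  [TopologicalSpace Y] [T2Space Y] [MeasurableSpace Y] [BorelSpace Y] [NormedAddCommGroup E]
  [NormedSpace ℝ E]

theorem tendsto_integral_integral_cutoff {μ : Measure X} {ν : Measure Y} [IsFiniteMeasure μ]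
    [IsFiniteMeasure ν] {χ : ℕ → C_c(X, ℝ)} {ψ : ℕ → C_c(Y, ℝ)}
    (hχ : ∀ n x, χ n x ∈ Icc (0 : ℝ) 1) (hψ : ∀ n y, ψ n y ∈ Icc (0 : ℝ) 1)
    (hχμ : ∀ᵐ x ∂μ, Tendsto (fun n => χ n x) atTop (𝓝 1))
    (hψν : ∀ᵐ y ∂ν, Tendsto (fun n => ψ n y) atTop (𝓝 1))
    {φ : X → Y → E} (hφ : Continuous φ.uncurry) {C : ℝ} (hC : ∀ x y, ‖φ x y‖ ≤ C) :
    Tendsto (fun n => ∫ x, ∫ y, (χ n x * ψ n y) • φ x y ∂ν ∂μ) atTop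
      (𝓝 (∫ x, ∫ y, φ x y ∂ν ∂μ)) := by
  have hbound : ∀ n x y, ‖(χ n x * ψ n y) • φ x y‖ ≤ C := fun n x y => by
    have hχψ := mul_nonneg (hχ n x).1 (hψ n y).1
    rw [norm_smul_of_nonneg hχψ]
    exact (mul_le_of_le_one_left (norm_nonneg _)
      (mul_le_one₀ (hχ n x).2 (hψ n y).1 (hψ n y).2)).trans (hC x y)
  have hcont : ∀ n, Continuous (Function.uncurry fun x y => (χ n x * ψ n y) • φ x y) := fun n =>
    (((χ n).continuous.comp continuous_fst).mul ((ψ n).continuous.comp continuous_snd)).smul hφ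
  have hinner : ∀ n, Continuous fun x => ∫ y, (χ n x * ψ n y) • φ x y ∂ν := fun n =>
    continuousOn_univ.1 <| continuousOn_integral_of_compact_support (ψ n).hasCompactSupport
      (hcont n).continuousOn fun x y _ hy => by simp [image_eq_zero_of_notMem_tsupport hy]
  refine tendsto_integral_of_dominated_convergence (fun _ => C * ν.real univ) (fun n => ?_)
    (integrable_const _)
    (fun n => ae_of_all _ fun x => norm_integral_le_of_norm_le_const (ae_of_all _ (hbound n x)))
    (hχμ.mono fun x hx => ?_)
  · refine ((hinner n).stronglyMeasurable_of_hasCompactSupport <|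
      HasCompactSupport.intro (χ n).hasCompactSupport fun x hx => ?_).aestronglyMeasurable
    simp [image_eq_zero_of_notMem_tsupport hx]
  · refine tendsto_integral_of_dominated_convergence (fun _ => C) (fun n => ?_)
      (integrable_const C) (fun n => ae_of_all _ (hbound n x)) (hψν.mono fun y hy => ?_)
    · refine (((hcont n).comp (Continuous.prodMk_right x)).stronglyMeasurable_of_hasCompactSupport
        <| HasCompactSupport.intro (ψ n).hasCompactSupport fun y hy => ?_).aestronglyMeasurable
      simp [image_eq_zero_of_notMem_tsupport hy]
    · simpa using (hx.mul hy).smul_const (φ x y)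

variable [LocallyCompactSpace X] [LocallyCompactSpace Y]

theorem exists_compactlySupported_ae_tendsto_one (μ : Measure X) [IsFiniteMeasure μ] [μ.Regular] :
    ∃ χ : ℕ → C_c(X, ℝ), (∀ n x, χ n x ∈ Icc (0 : ℝ) 1) ∧
      ∀ᵐ x ∂μ, Tendsto (fun n => χ n x) atTop (𝓝 1) := by
  obtain ⟨δ, hδ, hδsum⟩ := ENNReal.exists_pos_sum_of_countable one_ne_zero ℕ
  have htight := isTightMeasureSet_iff_exists_isCompact_measure_compl_le.1
    (isTightMeasureSet_singleton_of_innerRegular (μ := μ))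
  choose S hS hSμ using fun n => htight (δ n) (ENNReal.coe_pos.2 (hδ n))
  choose χ hχS _ hχ using fun n =>
    exists_compactlySupported_one_zero (hS n) isClosed_empty (disjoint_empty (S n))
  have hsum : ∑' n, μ (S n)ᶜ ≠ ⊤ :=
    ((ENNReal.tsum_le_tsum fun n => hSμ n μ rfl).trans_lt (hδsum.trans ENNReal.one_lt_top)).ne
  refine ⟨χ, hχ, (ae_eventually_notMem hsum).mono fun x hx => ?_⟩
  exact tendsto_const_nhds.congr' (hx.mono fun n hn => (hχS n (not_not.1 hn)).symm)

/- Without second countability `φ` need not be measurable for the product `σ`-algebra, so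
`integral_integral_swap` does not apply; cutting off reduces to compactly supported integrands. -/
theorem integral_integral_swap_of_continuous_of_bounded (μ : Measure X) (ν : Measure Y)
    [IsFiniteMeasure μ] [μ.Regular] [IsFiniteMeasure ν] [ν.Regular] {φ : X → Y → E}
    (hφ : Continuous φ.uncurry) {C : ℝ} (hC : ∀ x y, ‖φ x y‖ ≤ C) :
    ∫ x, ∫ y, φ x y ∂ν ∂μ = ∫ y, ∫ x, φ x y ∂μ ∂ν := by
  obtain ⟨χ, hχ, hχμ⟩ := exists_compactlySupported_ae_tendsto_one μ
  obtain ⟨ψ, hψ, hψν⟩ := exists_compactlySupported_ae_tendsto_one ν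
  have hswap : ∀ n, ∫ x, ∫ y, (χ n x * ψ n y) • φ x y ∂ν ∂μ =
      ∫ y, ∫ x, (ψ n y * χ n x) • φ x y ∂μ ∂ν := fun n => by
    simp only [mul_comm (ψ n _)]
    refine integral_integral_swap_of_hasCompactSupport ((((χ n).continuous.comp continuous_fst).mul
      ((ψ n).continuous.comp continuous_snd)).smul hφ) (HasCompactSupport.intro
      ((χ n).hasCompactSupport.prod (ψ n).hasCompactSupport) fun ⟨x, y⟩ hxy => ?_)
    rcases not_and_or.1 hxy with hx | hy
    · simp [image_eq_zero_of_notMem_tsupport hx]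
    · simp [image_eq_zero_of_notMem_tsupport hy]
  exact tendsto_nhds_unique (tendsto_integral_integral_cutoff hχ hψ hχμ hψν hφ hC)
    ((tendsto_integral_integral_cutoff hψ hχ hψν hχμ (φ := fun y x => φ x y)
      (hφ.comp continuous_swap) fun y x => hC x y).congr fun n => (hswap n).symm)

end Fubini

namespace PosMeasure

variable {K : Type*} [TopologicalSpace K] [MeasurableSpace K]

instance (μ : PosMeasure K) : IsFiniteMeasure μ.1 := μ.2.1

instance (μ : PosMeasure K) : μ.1.Regular := μ.2.2

/-- The point mass `δ_x`. -/
noncomputable def dirac [T1Space K] [BorelSpace K] (x : K) : PosMeasure K :=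
  ⟨Measure.dirac x, inferInstance, regular_dirac_of_t1 x⟩

theorem support_dirac [T1Space K] [BorelSpace K] (x : K) : (dirac x).1.support = {x} :=
  _root_.support_dirac x

theorem ext_of_integral_eq [T2Space K] [LocallyCompactSpace K] [BorelSpace K] {μ ν : PosMeasure K}
    (h : ∀ f : C_c(K, ℝ), ∫ x, f x ∂μ.1 = ∫ x, f x ∂ν.1) : μ = ν :=
  Subtype.ext (Measure.ext_of_integral_eq_on_compactlySupported h)

end PosMeasure

section BoundedMass

variable {X : Type*} [MeasurableSpace X]

theorem isFiniteMeasure_of_univ_le {μ : Measure X} {c : NNReal} (hμ : μ univ ≤ c) :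
    IsFiniteMeasure μ :=
  ⟨hμ.trans_lt ENNReal.coe_lt_top⟩

theorem norm_integral_le_of_univ_le {E : Type*} [NormedAddCommGroup E] [NormedSpace ℝ E]
    {μ : Measure X} {c : NNReal} (hμ : μ univ ≤ c) {f : X → E} {C : ℝ} (hC₀ : 0 ≤ C)
    (hC : ∀ x, ‖f x‖ ≤ C) : ‖∫ x, f x ∂μ‖ ≤ C * c := by
  have := isFiniteMeasure_of_univ_le hμ
  exact (norm_integral_le_of_norm_le_const (ae_of_all _ hC)).trans
    (mul_le_mul_of_nonneg_left (ENNReal.toReal_le_coe_of_le_coe hμ) hC₀)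

end BoundedMass

section WeakStar

variable {X ι : Type*} [TopologicalSpace X] [MeasurableSpace X] [BorelSpace X]

theorem integrable_zeroAtInfty (f : C₀(X, ℝ)) (μ : Measure X) [IsFiniteMeasure μ] :
    Integrable f μ :=
  BoundedContinuousFunction.integrable μ f.toBCF

theorem integrable_compactlySupported (f : C_c(X, ℝ)) (μ : Measure X)
    [IsFiniteMeasureOnCompacts μ] : Integrable f μ :=
  f.continuous.integrable_of_hasCompactSupport f.hasCompactSupport

theorem exists_positiveLinearMap_tendsto_integral (U : Ultrafilter ι) {m : ι → Measure X}
    {c : NNReal} (hm : ∀ i, m i univ ≤ c) : ∃ Λ : C_c(X, ℝ) →ₚ[ℝ] ℝ,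
      ∀ f : C_c(X, ℝ), Tendsto (fun i => ∫ x, f x ∂(m i)) U (𝓝 (Λ f)) := by
  have hlim : ∀ f : C_c(X, ℝ), ∃ a, Tendsto (fun i => ∫ x, f x ∂(m i)) U (𝓝 a) := fun f => by
    obtain ⟨C, hC⟩ := f.hasCompactSupport.exists_bound_of_continuous f.continuous
    have hmem : ∀ i, ∫ x, f x ∂(m i) ∈ Metric.closedBall 0 (max C 0 * c) := fun i =>
      mem_closedBall_zero_iff.2 <| norm_integral_le_of_univ_le (hm i) (le_max_right C 0)
        fun x => (hC x).trans (le_max_left C 0)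
    obtain ⟨a, -, ha⟩ := (isCompact_closedBall (0 : ℝ) _).ultrafilter_le_nhds
      (U.map fun i => ∫ x, f x ∂(m i)) (tendsto_principal.2 (Eventually.of_forall hmem))
    exact ⟨a, ha⟩
  choose L hL using hlim
  have hfin i := isFiniteMeasure_of_univ_le (hm i)
  refine ⟨PositiveLinearMap.mk₀
    { toFun := L
      map_add' := fun f g => tendsto_nhds_unique (hL (f + g)) <|
        ((hL f).add (hL g)).congr fun i => (integral_add (integrable_compactlySupported f _)
          (integrable_compactlySupported g _)).symm
      map_smul' := fun a f => tendsto_nhds_unique (hL (a • f)) <|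
        ((hL f).const_mul a).congr fun i => (integral_const_mul a _).symm }
    fun f hf => ge_of_tendsto' (hL f) fun i => integral_nonneg hf, hL⟩

variable [T2Space X] [LocallyCompactSpace X]

theorem measure_univ_le_of_forall_integral_le {μ : Measure X} [μ.Regular] {c : NNReal}
    (h : ∀ f : C_c(X, ℝ), (∀ x, f x ∈ Icc (0 : ℝ) 1) → ∫ x, f x ∂μ ≤ c) : μ univ ≤ c := by
  rw [isOpen_univ.measure_eq_iSup_isCompact]
  refine iSup₂_le fun S _ => iSup_le fun hS => ?_
  obtain ⟨χ, hχS, -, hχ⟩ :=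
    exists_compactlySupported_one_zero hS isClosed_empty (disjoint_empty S)
  calc μ S = ∫⁻ x in S, ENNReal.ofReal (χ x) ∂μ := by
        rw [setLIntegral_congr_fun (g := 1) hS.measurableSet fun x hx => by simp [hχS hx]]
        simp
    _ ≤ ∫⁻ x, ENNReal.ofReal (χ x) ∂μ := setLIntegral_le_lintegral _ _
    _ = ENNReal.ofReal (∫ x, χ x ∂μ) := (ofReal_integral_eq_lintegral_ofReal
        (integrable_compactlySupported χ μ) (ae_of_all _ fun x => (hχ x).1)).symm
    _ ≤ c := by simpa using ENNReal.ofReal_le_ofReal (h χ hχ)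

theorem tendsto_integral_zeroAtInfty_of_compactlySupported {l : Filter ι} {m : ι → Measure X}
    {μ : Measure X} {c : NNReal} (hm : ∀ i, m i univ ≤ c) (hμ : μ univ ≤ c)
    (h : ∀ f : C_c(X, ℝ), Tendsto (fun i => ∫ x, f x ∂(m i)) l (𝓝 (∫ x, f x ∂μ)))
    (f : C₀(X, ℝ)) : Tendsto (fun i => ∫ x, f x ∂(m i)) l (𝓝 (∫ x, f x ∂μ)) := by
  refine Metric.tendsto_nhds.2 fun ε hε => ?_
  set η : ℝ := ε / (2 * c + 1)
  have hη : 0 < η := by positivity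
  obtain ⟨g, hg⟩ := exists_compactlySupported_dist_le f hη
  have hfg : ∀ {ν : Measure X}, ν univ ≤ c → dist (∫ x, f x ∂ν) (∫ x, g x ∂ν) ≤ η * c :=
    fun {ν} hν => by
      have := isFiniteMeasure_of_univ_le hν
      rw [dist_eq_norm, ← integral_sub (integrable_zeroAtInfty f ν)
        (integrable_compactlySupported g ν)]
      exact norm_integral_le_of_univ_le hν hη.le fun x => by simpa [dist_eq_norm] using hg x
  filter_upwards [Metric.tendsto_nhds.1 (h g) η hη] with i hi
  calc dist (∫ x, f x ∂(m i)) (∫ x, f x ∂μ)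
      ≤ dist (∫ x, f x ∂(m i)) (∫ x, g x ∂(m i)) + dist (∫ x, g x ∂(m i)) (∫ x, g x ∂μ) +
          dist (∫ x, g x ∂μ) (∫ x, f x ∂μ) := dist_triangle4 _ _ _ _
    _ < η * c + η + η * c := by
        exact add_lt_add_of_lt_of_le (add_lt_add_of_le_of_lt (hfg (hm i)) hi)
          (dist_comm (∫ x, f x ∂μ) _ ▸ hfg hμ)
    _ = η * (2 * c + 1) := by ring
    _ = ε := div_mul_cancel₀ _ (by positivity)

theorem exists_posMeasure_tendsto_integral (U : Ultrafilter ι) {m : ι → Measure X} {c : NNReal}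
    (hm : ∀ i, m i univ ≤ c) : ∃ μ : PosMeasure X, μ.1 univ ≤ c ∧
      ∀ f : C₀(X, ℝ), Tendsto (fun i => ∫ x, f x ∂(m i)) U (𝓝 (∫ x, f x ∂μ.1)) := by
  obtain ⟨Λ, hΛ⟩ := exists_positiveLinearMap_tendsto_integral U hm
  simp only [← RealRMK.integral_rieszMeasure] at hΛ
  have hmass : RealRMK.rieszMeasure Λ univ ≤ c :=
    measure_univ_le_of_forall_integral_le fun f hf => le_of_tendsto' (hΛ f) fun i => by
      have hfi := norm_integral_le_of_univ_le (hm i) (f := f) zero_le_one fun x =>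
        (abs_of_nonneg (hf x).1).le.trans (hf x).2
      exact (le_abs_self _).trans (by simpa using hfi)
  exact ⟨⟨RealRMK.rieszMeasure Λ, isFiniteMeasure_of_univ_le hmass, inferInstance⟩, hmass,
    tendsto_integral_zeroAtInfty_of_compactlySupported hm hmass hΛ⟩

end WeakStar

namespace PointConvolution

variable {K : Type*} [TopologicalSpace K] [MeasurableSpace K] [BorelSpace K]
  (H : PointConvolution K)

instance (x y : K) : (H.mul x y : Measure K).Regular := H.regular_mul x y

theorem exists_abs_translate_le (f : C_c(K, ℝ)) : ∃ C, ∀ x y, |H.translate f x y| ≤ C :=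
  let ⟨C, hC⟩ := f.hasCompactSupport.exists_bound_of_continuous f.continuous
  ⟨C, H.abs_translate_le hC⟩

theorem translate_pos_iff {f : C_c(K, ℝ)} (hf : 0 ≤ f) {x y : K} :
    0 < H.translate f x y ↔ ∃ t ∈ (H.mul x y : Measure K).support, 0 < f t :=
  integral_pos_iff_exists_mem_support f.continuous hf (integrable_compactlySupported f _)

theorem translate_eq_zero_of_disjoint {f : C_c(K, ℝ)} {x y : K}
    (hf : Disjoint (H.mul x y : Measure K).support (tsupport f)) : H.translate f x y = 0 :=
  integral_eq_zero_of_ae <| mem_of_superset Measure.support_mem_ae_of_regular fun _ ht =>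
    image_eq_zero_of_notMem_tsupport (disjoint_left.1 hf ht)

variable [T2Space K] [LocallyCompactSpace K]

theorem integral_convolve_dirac (μ : PosMeasure K) (y : K) (f : C_c(K, ℝ)) :
    ∫ t, f t ∂(H.convolve μ (.dirac y)).1 = ∫ x, H.translate f x y ∂μ.1 := by
  rw [H.integral_convolve]
  exact integral_dirac _ y

theorem convolve_univ_le (μ ν : PosMeasure K) :
    (H.convolve μ ν).1 univ ≤ μ.1 univ * ν.1 univ := by
  rw [← ENNReal.coe_toNNReal (measure_ne_top μ.1 univ),
    ← ENNReal.coe_toNNReal (measure_ne_top ν.1 univ), ← ENNReal.coe_mul]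
  refine measure_univ_le_of_forall_integral_le fun f hf => ?_
  have hf₁ : ∀ t, |f t| ≤ 1 := fun t => (abs_of_nonneg (hf t).1).le.trans (hf t).2
  have hinner : ∀ y, ‖∫ x, H.translate f x y ∂μ.1‖ ≤ (μ.1 univ).toNNReal := fun y => by
    simpa only [one_mul] using norm_integral_le_of_univ_le (f := fun x => H.translate f x y)
      (ENNReal.coe_toNNReal (measure_ne_top μ.1 univ)).ge zero_le_one
      fun x => H.abs_translate_le hf₁ x y
  rw [H.integral_convolve, NNReal.coe_mul]
  exact (le_abs_self _).trans <| norm_integral_le_of_univ_le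
    (f := fun y => ∫ x, H.translate f x y ∂μ.1)
    (ENNReal.coe_toNNReal (measure_ne_top ν.1 univ)).ge NNReal.zero_le_coe hinner

end PointConvolution

namespace Hypergroup

variable {K : Type*} [TopologicalSpace K] [T2Space K] [LocallyCompactSpace K]
  [MeasurableSpace K] [BorelSpace K] (H : Hypergroup K)

theorem mem_setMul {A B : Set K} {t : K} :
    t ∈ H.setMul A B ↔ ∃ x ∈ A, ∃ y ∈ B, t ∈ (H.mul x y : Measure K).support := by
  simp only [setMul, mem_iUnion, exists_prop]

theorem setMul_subset_iff {A B C : Set K} :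
    H.setMul A B ⊆ C ↔ ∀ x ∈ A, ∀ y ∈ B, (H.mul x y : Measure K).support ⊆ C := by
  simp only [setMul, iUnion_subset_iff]

theorem setMul_mono {A A' B B' : Set K} (hA : A ⊆ A') (hB : B ⊆ B') :
    H.setMul A B ⊆ H.setMul A' B' :=
  biUnion_mono hA fun _ _ => biUnion_mono hB fun _ _ => Subset.rfl

theorem setMul_singleton (x y : K) : H.setMul {x} {y} = (H.mul x y : Measure K).support := by
  simp only [setMul, mem_singleton_iff, iUnion_iUnion_eq_left]

theorem singleton_e_setMul (A : Set K) : H.setMul {H.e} A = A := by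
  simp [setMul, H.e_mul, support_dirac]

theorem isCompact_setMul {A B : Set K} (hA : IsCompact A) (hB : IsCompact B) :
    IsCompact (H.setMul A B) := by
  let F : K × K → TopologicalSpace.Compacts K := fun p => ⟨_, H.isCompact_support p.1 p.2⟩
  have hF : Continuous F := by
    let := TopologicalSpace.vietoris K
    exact TopologicalSpace.Compacts.isEmbedding_coe.continuous_iff.2 H.continuous_support
  convert! TopologicalSpace.Compacts.isCompact_biUnion_coe_of_isCompact
    ((hA.prod hB).image hF) using 1
  ext t
  simp [mem_setMul, F, and_assoc]

theorem integral_convolve_pos_iff (μ ν : PosMeasure K) {f : C_c(K, ℝ)} (hf : 0 ≤ f) :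
    0 < ∫ t, f t ∂(H.convolve μ ν).1 ↔ ∃ t ∈ H.setMul μ.1.support ν.1.support, 0 < f t := by
  obtain ⟨C, hC⟩ := H.exists_abs_translate_le f
  have htranslate : ∀ x y, 0 ≤ H.translate f x y := fun x y => integral_nonneg hf
  have houter := integral_pos_iff_exists_mem_support (μ := ν.1)
    (continuous_integral_of_regular μ.1 (H.continuous_translate f) hC)
    (fun y => integral_nonneg fun x => htranslate x y) (H.integrable_outer μ.1 ν.1 f)
  have hinner : ∀ y, 0 < ∫ x, H.translate f x y ∂μ.1 ↔
      ∃ x ∈ μ.1.support, 0 < H.translate f x y := fun y =>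
    integral_pos_iff_exists_mem_support
      ((H.continuous_translate f).comp (Continuous.prodMk_left y)) (fun x => htranslate x y)
      (H.integrable_inner μ.1 f y)
  simp only [H.integral_convolve, houter, hinner, H.translate_pos_iff hf, mem_setMul]
  grind

theorem support_convolve (μ ν : PosMeasure K) :
    (H.convolve μ ν).1.support = closure (H.setMul μ.1.support ν.1.support) := by
  have hpos : ∀ f : C_c(K, ℝ), 0 ≤ f → ((∃ t ∈ (H.convolve μ ν).1.support, 0 < f t) ↔
      ∃ t ∈ H.setMul μ.1.support ν.1.support, 0 < f t) := fun f hf =>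
    (integral_pos_iff_exists_mem_support (g := f) f.continuous hf
      (integrable_compactlySupported f _)).symm.trans (H.integral_convolve_pos_iff μ ν hf)
  refine Subset.antisymm ?_ (closure_minimal ?_ Measure.isClosed_support)
  · exact subset_closure_of_forall_exists_pos fun f hf t ht hft => (hpos f hf).1 ⟨t, ht, hft⟩
  · exact (subset_closure_of_forall_exists_pos fun f hf t ht hft =>
      (hpos f hf).2 ⟨t, ht, hft⟩).trans Measure.isClosed_support.closure_eq.subset

theorem setMul_assoc_singleton (x y z : K) :
    H.setMul (H.setMul {x} {y}) {z} = H.setMul {x} (H.setMul {y} {z}) := by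
  have hclosed : ∀ {A B : Set K}, IsCompact A → IsCompact B →
      closure (H.setMul A B) = H.setMul A B := fun hA hB =>
    (H.isCompact_setMul hA hB).isClosed.closure_eq
  have hpair : ∀ a b : K, IsCompact (H.setMul {a} {b}) := fun a b =>
    H.isCompact_setMul isCompact_singleton isCompact_singleton
  have hsupp := congrArg (fun μ : PosMeasure K => μ.1.support)
    (H.assoc (.dirac x) (.dirac y) (.dirac z))
  simpa only [support_convolve, PosMeasure.support_dirac, hclosed, hpair,
    isCompact_singleton] using hsupp

theorem setMul_assoc (A B C : Set K) :
    H.setMul (H.setMul A B) C = H.setMul A (H.setMul B C) := by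
  have hpoint := fun x y z t => Set.ext_iff.1 (H.setMul_assoc_singleton x y z) t
  simp only [mem_setMul, mem_singleton_iff, exists_eq_left] at hpoint
  ext t
  simp only [mem_setMul]
  constructor
  · rintro ⟨s, ⟨x, hx, y, hy, hs⟩, z, hz, ht⟩
    obtain ⟨r, hr, ht⟩ := (hpoint x y z t).1 ⟨s, hs, ht⟩
    exact ⟨x, hx, r, ⟨y, hy, z, hz, hr⟩, ht⟩
  · rintro ⟨x, hx, r, ⟨y, hy, z, hz, hr⟩, ht⟩
    obtain ⟨s, hs, ht⟩ := (hpoint x y z t).2 ⟨r, hr, ht⟩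
    exact ⟨s, ⟨x, hx, y, hy, hs⟩, z, hz, ht⟩

theorem support_nonempty (x y : K) : (H.mul x y : Measure K).support.Nonempty :=
  nonempty_of_mem (f := ae (H.mul x y : Measure K)) Measure.support_mem_ae_of_regular

theorem inv_mem_support {x y t : K} (ht : t ∈ (H.mul x y : Measure K).support) :
    H.inv t ∈ (H.mul (H.inv y) (H.inv x) : Measure K).support := by
  rw [← H.map_inv_mul, Measure.mem_support_iff_forall]
  intro U hU
  calc 0 < (H.mul x y : Measure K) (H.inv ⁻¹' U) :=
        (Measure.mem_support_iff_forall t).1 ht _ (H.continuous_inv.continuousAt hU)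
    _ ≤ (H.mul x y : Measure K).map H.inv U :=
        Measure.le_map_apply H.continuous_inv.aemeasurable U

theorem mem_support_inv_mul {x y t : K} (ht : t ∈ (H.mul x y : Measure K).support) :
    y ∈ (H.mul (H.inv x) t : Measure K).support := by
  -- As `e ∈ ť * t ⊆ ť * (x * y) = (ť * x) * y`, the involution `y̌` lies in `ť * x`.
  have he : H.e ∈ H.setMul {H.inv t} (H.setMul {x} {y}) :=
    H.mem_setMul.2 ⟨_, rfl, t, by rwa [setMul_singleton], (H.e_mem_support_iff _ _).2 rfl⟩
  rw [← setMul_assoc, setMul_singleton, mem_setMul] at he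
  obtain ⟨w, hw, _, rfl, hwy⟩ := he
  simpa only [(H.e_mem_support_iff _ _).1 hwy, H.inv_inv] using H.inv_mem_support hw

theorem mem_support_mul_inv {x y t : K} (ht : t ∈ (H.mul x y : Measure K).support) :
    x ∈ (H.mul t (H.inv y) : Measure K).support := by
  simpa only [H.inv_inv] using
    H.inv_mem_support (H.mem_support_inv_mul (H.inv_mem_support ht))

theorem setMul_univ_left {A : Set K} (hA : A.Nonempty) : H.setMul univ A = univ := by
  obtain ⟨a, ha⟩ := hA
  refine eq_univ_of_forall fun y => ?_
  obtain ⟨w, hw⟩ := H.support_nonempty y (H.inv a)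
  exact H.mem_setMul.2 ⟨w, mem_univ w, a, ha, by simpa [H.inv_inv] using H.mem_support_mul_inv hw⟩

theorem setMul_closure_subset (A B : Set K) :
    H.setMul (closure A) B ⊆ closure (H.setMul A B) := by
  refine subset_closure_of_forall_exists_pos fun f hf t ht hft => ?_
  obtain ⟨x, hx, b, hb, ht⟩ := H.mem_setMul.1 ht
  have hcont : Continuous fun s => H.translate f s b :=
    (H.continuous_translate f).comp (Continuous.prodMk_left b)
  obtain ⟨a, hfa, ha⟩ := mem_closure_iff.1 hx _ (isOpen_lt continuous_const hcont)
    ((H.translate_pos_iff hf).2 ⟨t, ht, hft⟩)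
  obtain ⟨s, hs, hfs⟩ := (H.translate_pos_iff hf).1 hfa
  exact ⟨s, H.mem_setMul.2 ⟨a, ha, b, hb, hs⟩, hfs⟩

theorem setPow_setMul_subset {A B : Set K} (h : H.setMul B A ⊆ A) (n : ℕ) :
    H.setMul (H.setPow B n) A ⊆ A := by
  induction n with
  | zero => exact (H.singleton_e_setMul A).subset
  | succ n ih =>
    rw [setPow, setMul_assoc]
    exact (H.setMul_mono Subset.rfl h).trans ih

theorem eq_univ_of_setMul_subset {σ : PosMeasure K} (hσ : H.IsNondegenerate σ) {A : Set K}
    (hA : IsClosed A) (hne : A.Nonempty) (hσA : H.setMul σ.1.support A ⊆ A) : A = univ := by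
  have hunion : H.setMul (⋃ n : ℕ, ⋃ _ : 1 ≤ n, H.setPow σ.1.support n) A ⊆ A := by
    refine H.setMul_subset_iff.2 fun x hx => ?_
    obtain ⟨n, -, hxn⟩ := mem_iUnion₂.1 hx
    exact H.setMul_subset_iff.1 (H.setPow_setMul_subset hσA n) x hxn
  refine univ_subset_iff.1 ?_
  calc univ = H.setMul univ A := (H.setMul_univ_left hne).symm
    _ ⊆ closure (H.setMul _ A) := by
        rw [← hσ]
        exact H.setMul_closure_subset _ A
    _ ⊆ A := closure_minimal hunion hA

section Averages

theorem eventually_cocompact_forall_translate_right_eq_zero (f : C_c(K, ℝ)) {S : Set K}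
    (hS : IsCompact S) : ∀ᶠ y in cocompact K, ∀ x ∈ S, H.translate f x y = 0 := by
  filter_upwards [(H.isCompact_setMul (hS.image H.continuous_inv)
    f.hasCompactSupport).compl_mem_cocompact] with y hy x hx
  exact H.translate_eq_zero_of_disjoint <| disjoint_left.2 fun t ht htf =>
    hy (H.mem_setMul.2 ⟨_, mem_image_of_mem _ hx, t, htf, H.mem_support_inv_mul ht⟩)

theorem eventually_cocompact_forall_translate_left_eq_zero (f : C_c(K, ℝ)) {S : Set K}
    (hS : IsCompact S) : ∀ᶠ x in cocompact K, ∀ y ∈ S, H.translate f x y = 0 := by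
  filter_upwards [(H.isCompact_setMul f.hasCompactSupport
    (hS.image H.continuous_inv)).compl_mem_cocompact] with x hx y hy
  exact H.translate_eq_zero_of_disjoint <| disjoint_left.2 fun t ht htf =>
    hx (H.mem_setMul.2 ⟨t, htf, _, mem_image_of_mem _ hy, H.mem_support_mul_inv ht⟩)

theorem tendsto_integral_translate_right_cocompact (μ : PosMeasure K) (f : C_c(K, ℝ)) :
    Tendsto (fun y => ∫ x, H.translate f x y ∂μ.1) (cocompact K) (𝓝 0) := by
  obtain ⟨C, hC⟩ := H.exists_abs_translate_le f
  refine tendsto_integral_zero_of_isTightMeasureSet isTightMeasureSet_singleton_of_innerRegular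
    (fun y x => hC x y) fun S hS => Metric.tendstoUniformlyOn_iff.2 fun ε hε => ?_
  filter_upwards [H.eventually_cocompact_forall_translate_right_eq_zero f hS] with y hy x hx
  simpa [hy x hx] using hε

theorem tendsto_integral_translate_left_cocompact (ν : PosMeasure K) (f : C_c(K, ℝ)) :
    Tendsto (fun x => ∫ y, H.translate f x y ∂ν.1) (cocompact K) (𝓝 0) := by
  obtain ⟨C, hC⟩ := H.exists_abs_translate_le f
  refine tendsto_integral_zero_of_isTightMeasureSet isTightMeasureSet_singleton_of_innerRegular
    hC fun S hS => Metric.tendstoUniformlyOn_iff.2 fun ε hε => ?_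
  filter_upwards [H.eventually_cocompact_forall_translate_left_eq_zero f hS] with x hx y hy
  simpa [hx y hy] using hε

/-- The average `y ↦ ∫ f(x * y) dμ(x)` of the left translates of `f`; as a map of `f` it is
the pre-adjoint of `ν ↦ μ * ν`. -/
noncomputable def leftAverage (μ : PosMeasure K) (f : C_c(K, ℝ)) : C₀(K, ℝ) where
  toFun y := ∫ x, H.translate f x y ∂μ.1
  continuous_toFun :=
    let ⟨_, hC⟩ := H.exists_abs_translate_le f
    continuous_integral_of_regular μ.1 (H.continuous_translate f) hC
  zero_at_infty' := H.tendsto_integral_translate_right_cocompact μ f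

/-- The average `x ↦ ∫ f(x * y) dν(y)` of the right translates of `f`; as a map of `f` it is
the pre-adjoint of `μ ↦ μ * ν`. -/
noncomputable def rightAverage (ν : PosMeasure K) (f : C_c(K, ℝ)) : C₀(K, ℝ) where
  toFun x := ∫ y, H.translate f x y ∂ν.1
  continuous_toFun :=
    let ⟨_, hC⟩ := H.exists_abs_translate_le f
    continuous_integral_of_regular (φ := fun y x => H.translate f x y) ν.1
      ((H.continuous_translate f).comp continuous_swap) fun y x => hC x y
  zero_at_infty' := H.tendsto_integral_translate_left_cocompact ν f

theorem integral_leftAverage (μ ν : PosMeasure K) (f : C_c(K, ℝ)) :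
    ∫ y, H.leftAverage μ f y ∂ν.1 = ∫ t, f t ∂(H.convolve μ ν).1 :=
  (H.integral_convolve μ ν f).symm

theorem integral_rightAverage (μ ν : PosMeasure K) (f : C_c(K, ℝ)) :
    ∫ x, H.rightAverage ν f x ∂μ.1 = ∫ t, f t ∂(H.convolve μ ν).1 := by
  obtain ⟨C, hC⟩ := H.exists_abs_translate_le f
  rw [H.integral_convolve]
  exact integral_integral_swap_of_continuous_of_bounded μ.1 ν.1 (H.continuous_translate f) hC

theorem leftAverage_apply_e (μ : PosMeasure K) (f : C_c(K, ℝ)) :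
    H.leftAverage μ f H.e = ∫ x, f x ∂μ.1 := by
  change ∫ x, ∫ t, f t ∂(H.mul x H.e : Measure K) ∂μ.1 = _
  simp only [H.mul_e, integral_dirac]

end Averages

section Harmonic

/-- `g` is `σ`-harmonic: `g(y) = ∫ g(x * y) dσ(x)` for all `y`, the right-hand side being written
as the integral of `g` against `σ * δ_y`. -/
def IsHarmonic (σ : PosMeasure K) (g : K → ℝ) : Prop :=
  ∀ y, g y = ∫ z, g z ∂(H.convolve σ (.dirac y)).1

theorem isHarmonic_leftAverage {μ σ : PosMeasure K} (h : H.convolve μ σ = μ) (f : C_c(K, ℝ)) :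
    H.IsHarmonic σ (H.leftAverage μ f) := fun y =>
  calc H.leftAverage μ f y = ∫ t, f t ∂(H.convolve μ (.dirac y)).1 :=
        (H.integral_convolve_dirac μ y f).symm
    _ = ∫ t, f t ∂(H.convolve μ (H.convolve σ (.dirac y))).1 := by rw [← H.assoc, h]
    _ = ∫ z, H.leftAverage μ f z ∂(H.convolve σ (.dirac y)).1 :=
        (H.integral_leftAverage μ _ f).symm

variable {H} {σ : PosMeasure K}

theorem IsHarmonic.neg {g : K → ℝ} (hg : H.IsHarmonic σ g) : H.IsHarmonic σ (-g) := fun y => by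
  simp only [Pi.neg_apply, integral_neg, ← hg y]

theorem IsHarmonic.setMul_subset_of_le (hσ₁ : σ.1 univ ≤ 1) {g : C₀(K, ℝ)}
    (hg : H.IsHarmonic σ g) {M : ℝ} (hM : 0 ≤ M) (hgM : ∀ x, g x ≤ M) :
    H.setMul σ.1.support {y | g y = M} ⊆ {y | g y = M} := by
  refine H.setMul_subset_iff.2 fun x hx y hy t ht => ?_
  have hmass : (H.convolve σ (.dirac y)).1 univ ≤ 1 :=
    (H.convolve_univ_le σ (.dirac y)).trans
      (mul_le_one' hσ₁ (prob_le_one (μ := Measure.dirac y)))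
  refine eq_of_mem_support_of_le_integral hmass g.continuous (integrable_zeroAtInfty g _) hM hgM
    (((hg y).symm.trans hy).ge) ?_
  rw [support_convolve, PosMeasure.support_dirac]
  exact subset_closure (H.mem_setMul.2 ⟨x, hx, y, rfl, ht⟩)

variable [NoncompactSpace K]

theorem IsHarmonic.nonpos (hσ₁ : σ.1 univ ≤ 1) (hσ : H.IsNondegenerate σ) {g : C₀(K, ℝ)}
    (hg : H.IsHarmonic σ g) (y : K) : g y ≤ 0 := by
  by_contra! hy
  obtain ⟨x, hx⟩ := g.continuous.exists_forall_ge' y (g.zero_at_infty'.eventually_le_const hy)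
  have hpos : 0 < g x := hy.trans_le (hx y)
  have hconst : {z | g z = g x} = univ :=
    H.eq_univ_of_setMul_subset hσ (isClosed_eq g.continuous continuous_const) ⟨x, rfl⟩
      (hg.setMul_subset_of_le hσ₁ hpos.le hx)
  have hlim : Tendsto g (cocompact K) (𝓝 (g x)) :=
    tendsto_const_nhds.congr fun z => (eq_univ_iff_forall.1 hconst z).symm
  exact hpos.ne' (tendsto_nhds_unique hlim g.zero_at_infty')

theorem IsHarmonic.eq_zero (hσ₁ : σ.1 univ ≤ 1) (hσ : H.IsNondegenerate σ) {g : C₀(K, ℝ)}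
    (hg : H.IsHarmonic σ g) : g = 0 :=
  ZeroAtInftyContinuousMap.ext fun y => le_antisymm (hg.nonpos hσ₁ hσ y) <|
    neg_nonpos.1 (IsHarmonic.nonpos (g := -g) hσ₁ hσ hg.neg y)

theorem eq_zero_of_convolve_eq_self (hσ₁ : σ.1 univ ≤ 1) (hσ : H.IsNondegenerate σ)
    {μ : PosMeasure K} (h : H.convolve μ σ = μ) : μ.1 = 0 :=
  Measure.ext_of_integral_eq_on_compactlySupported fun f => by
    rw [← H.leftAverage_apply_e, (H.isHarmonic_leftAverage h f).eq_zero hσ₁ hσ]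
    simp

end Harmonic

section Cesaro

variable {σ : PosMeasure K}

theorem power_univ_le_one (hσ₁ : σ.1 univ ≤ 1) (n : ℕ) : (H.power σ n).1 univ ≤ 1 := by
  induction n with
  | zero => exact prob_le_one (μ := Measure.dirac H.e)
  | succ n ih => exact (H.convolve_univ_le _ σ).trans (mul_le_one' ih hσ₁)

theorem cesaro_univ_le_one (hσ₁ : σ.1 univ ≤ 1) (n : ℕ) : H.cesaro σ n univ ≤ 1 := by
  have hsum : (∑ k ∈ Finset.Icc 1 n, (H.power σ k).1) univ ≤ n := by
    rw [Measure.finsetSum_apply]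
    simpa using Finset.sum_le_card_nsmul (Finset.Icc 1 n) _ 1 fun k _ => H.power_univ_le_one hσ₁ k
  rw [cesaro, Measure.smul_apply, ENNReal.smul_def, smul_eq_mul]
  calc _ ≤ ((n : NNReal)⁻¹ : NNReal) * ((n : NNReal) : ENNReal) := by gcongr; simpa using hsum
    _ ≤ 1 := by exact_mod_cast inv_mul_le_one

theorem integral_cesaro {E : Type*} [NormedAddCommGroup E] [NormedSpace ℝ E] {f : K → E}
    (hf : ∀ k, Integrable f (H.power σ k).1) (n : ℕ) :
    ∫ x, f x ∂(H.cesaro σ n) =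
      (n : ℝ)⁻¹ • ∑ k ∈ Finset.range n, ∫ x, f x ∂(H.power σ (k + 1)).1 := by
  rw [cesaro, integral_smul_nnreal_measure, integral_finsetSum_measure fun k _ => hf k,
    Finset.range_eq_Ico, Finset.sum_Ico_add' (fun k => ∫ x, f x ∂(H.power σ k).1) 0 n 1]
  simp [NNReal.smul_def, Finset.Ico_add_one_right_eq_Icc]

theorem integral_rightAverage_cesaro_sub (σ : PosMeasure K) (f : C_c(K, ℝ)) (n : ℕ) :
    ∫ x, H.rightAverage σ f x ∂(H.cesaro σ n) - ∫ x, f x ∂(H.cesaro σ n) =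
      (n : ℝ)⁻¹ * (∫ x, f x ∂(H.power σ (n + 1)).1 - ∫ x, f x ∂(H.power σ 1).1) := by
  rw [H.integral_cesaro fun _ => integrable_zeroAtInfty _ _,
    H.integral_cesaro fun _ => integrable_compactlySupported f _, ← smul_sub,
    ← Finset.sum_sub_distrib, smul_eq_mul,
    ← Finset.sum_range_sub fun k => ∫ x, f x ∂(H.power σ (k + 1)).1]
  simp only [integral_rightAverage, power]

theorem tendsto_integral_rightAverage_cesaro_sub (hσ₁ : σ.1 univ ≤ 1) (f : C_c(K, ℝ)) :
    Tendsto (fun n => ∫ x, H.rightAverage σ f x ∂(H.cesaro σ n) - ∫ x, f x ∂(H.cesaro σ n)) atTop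
      (𝓝 0) := by
  obtain ⟨C, hC⟩ := f.hasCompactSupport.exists_bound_of_continuous f.continuous
  have hpower : ∀ n, ‖∫ x, f x ∂(H.power σ n).1‖ ≤ max C 0 := fun n => by
    simpa using norm_integral_le_of_univ_le (c := 1) (by simpa using H.power_univ_le_one hσ₁ n)
      (le_max_right C 0) fun x => (hC x).trans (le_max_left C 0)
  simp only [integral_rightAverage_cesaro_sub]
  exact tendsto_inv_atTop_nhds_zero_nat.zero_mul_isBoundedUnder_le <|
    isBoundedUnder_of ⟨max C 0 + max C 0, fun n =>
      (norm_sub_le _ _).trans (add_le_add (hpower (n + 1)) (hpower 1))⟩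

variable [NoncompactSpace K]

theorem tendsto_integral_cesaro (hσ₁ : σ.1 univ ≤ 1) (hσ : H.IsNondegenerate σ) (f : C₀(K, ℝ)) :
    Tendsto (fun n => ∫ x, f x ∂(H.cesaro σ n)) atTop (𝓝 0) := by
  refine tendsto_iff_ultrafilter _ _ _ |>.2 fun U hU => ?_
  obtain ⟨μ, -, hμ⟩ := exists_posMeasure_tendsto_integral U (c := 1)
    fun n => by simpa using H.cesaro_univ_le_one hσ₁ n
  have hinv : H.convolve μ σ = μ := PosMeasure.ext_of_integral_eq fun g => by
    rw [← H.integral_rightAverage]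
    exact sub_eq_zero.1 <| tendsto_nhds_unique ((hμ (H.rightAverage σ g)).sub (hμ g))
      ((H.tendsto_integral_rightAverage_cesaro_sub hσ₁ g).mono_left hU)
  simpa [eq_zero_of_convolve_eq_self hσ₁ hσ hinv] using hμ f

end Cesaro

end Hypergroup

theorem mainTheorem12_general {K : Type*} [TopologicalSpace K] [T2Space K] [LocallyCompactSpace K]
    [NoncompactSpace K] [MeasurableSpace K] [BorelSpace K] (H : Hypergroup K) (σ : PosMeasure K)
    (hσ₁ : σ.1 univ ≤ 1) (hσ : H.IsNondegenerate σ) {E : Type*} [NormedAddCommGroup E]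
    [NormedSpace ℝ E] (f : C₀(K, E)) :
    Tendsto (fun n : ℕ => ∫ x, f x ∂(H.cesaro σ n)) atTop (𝓝 0) := by
  let normf : C₀(K, ℝ) :=
    ⟨⟨fun x => ‖f x‖, f.continuous.norm⟩, by simpa using f.zero_at_infty'.norm⟩
  exact squeeze_zero_norm (fun n => norm_integral_le_integral_norm f)
    (H.tendsto_integral_cesaro hσ₁ hσ normf)

theorem mainTheorem12 {K : Type*} [TopologicalSpace K] [T2Space K] [LocallyCompactSpace K]
    [NoncompactSpace K] [MeasurableSpace K] [BorelSpace K] (H : Hypergroup K)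
    (ω : Measure K) (hω : H.IsLeftHaar ω)
    (σ : PosMeasure K) (hσ₁ : IsProbabilityMeasure σ.1) (hσ : H.IsNondegenerate σ) :
    ∀ f : C₀(K, ℂ),
      Tendsto (fun n : ℕ => ∫ x, f x ∂(H.cesaro σ n)) atTop (𝓝 0) := by
  intro f
  exact mainTheorem12_general H σ hσ₁.measure_univ.le hσ f
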